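/- Fix a universal reference machine $U$, that is, a partial recursive function $(p,y)\mapsto U(p,y)$ taking a binary program $p$ and an input $y\in\mathbb N$ to binary strings, such that for every partial recursive $T$ of the same kind there is a constant $c$ for which $T(p,y)=x$ implies $U(q,y)=x$ for some $q$ with $|q|\le |p|+c$. Let $C(x\mid y)=\min\{|p| : U(p,y)=x\}$. A labeled graph $G$ on $n$ nodes is coded by the string $E(G)$ of $n(n-1)/2$ bits which lists, for the pairs $u<v$ of nodes in lexicographic order, whether $\{u,v\}$ is an edge. For $\delta:\mathbb N\to\mathbb R$ call $G$ $\delta(n)$-random if $C(E(G)\mid n,\delta)\ge n(n-1)/2-\delta(n)$, where $\delta$ is presented in the condition by an arbitrary natural number $d$ (for instance the value $\delta(n)$ or a program for $\delta$). A routing scheme $F$ on $G$ assigns to every node $u$ a local routing function $F(u)$, which gives for each destination $w\ne u$ reachable from $u$ a neighbour of $u$ to which messages for $w$ are forwarded. It is a shortest path routing scheme if, for all $u,w$ joined by a path, the route from $u$ to $w$ obtained in this way reaches $w$ in exactly $\mathrm{dist}_G(u,w)$ steps. Nodes are not relabeled and know their neighbours: for a fixed partial recursive interpreter $D$, a bit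 string $s$ stores $F(u)$ at $u$ if for each destination $w\neq u$ reachable from $u$, $D$ computes the label of $F(u)(w)$ from $s$, $n$, the label of $u$, the list of the labels of the neighbours of $u$, and the label of $w$. Theorem. Let $U$ be a universal reference machine, $D$ a partial recursive interpreter, and $\delta(n)=o(n)$. Then there are functions $f(n)=o(n)$ and $g(n)=o(n^2)$ such that for every $n$, every $\delta(n)$-random labeled graph $G$ on $n$ nodes (for whatever $d$), and every shortest path routing scheme $F$ on $G$: (1) for each node $u$, every bit string that stores $F(u)$ at $u$ has length at least $n/2-f(n)$; (2) if for each node $u$ the string $s_u$ stores $F(u)$ at $u$, then $\sum_u |s_u|\ge n^2/2-g(n)$. -/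

import Mathlib

namespace CompactRouting

/-! ### Kolmogorov complexity -/

/-- A (partial) description method: `M p y` is the output, if any, of the binary program `p`
when `y` is given as input. -/
abbrev Machine : Type := List Bool → ℕ →. List Bool

/-- `U` is a universal reference machine: it is partial recursive, and it simulates every
partial recursive description method at the price of a constant number of extra program bits. -/
def IsUniversal (U : Machine) : Prop :=
  Partrec₂ U ∧ ∀ T : Machine, Partrec₂ T →
    ∃ c : ℕ, ∀ (p : List Bool) (y : ℕ) (x : List Bool), x ∈ T p y →
      ∃ q : List Bool, q.length ≤ p.length + c ∧ x ∈ U q y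

/-- The conditional Kolmogorov complexity `C(x | y)` with respect to the machine `U`: the length
of a shortest program that outputs `x` on input `y`. (For universal `U` the set is nonempty.) -/
noncomputable def condComplexity (U : Machine) (x : List Bool) (y : ℕ) : ℕ :=
  sInf {k | ∃ p : List Bool, p.length = k ∧ x ∈ U p y}

theorem exists_program {U : Machine} (hU : IsUniversal U) (x : List Bool) (y : ℕ) :
    ∃ p : List Bool, x ∈ U p y := by
  obtain ⟨c, hc⟩ := hU.2 (fun p _ => Part.some p) Computable.fst.partrec.to₂
  obtain ⟨q, -, hq⟩ := hc x y x (Part.mem_some x)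
  exact ⟨q, hq⟩

/-- The standard universal machine: the program `1ⁱ 0 p` runs the `i`-th partial recursive
function on the pair of `p` and the input `y`. -/
def standardMachine : Machine := fun q y =>
  ((Denumerable.ofNat Nat.Partrec.Code (q.findIdx not)).eval
    (Encodable.encode (q.drop (q.findIdx not + 1), y))).bind
      fun r => (Encodable.decode r : Option (List Bool))

theorem standardMachine_isUniversal : IsUniversal standardMachine := by
  have hidx : Primrec fun q : List Bool => q.findIdx not :=
    Primrec.list_findIdx Primrec.id (Primrec.not.comp Primrec.snd).to₂
  refine ⟨?_, fun T hT => ?_⟩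
  · refine Partrec.bind (Nat.Partrec.Code.eval_part.comp
      ((Computable.ofNat _).comp (hidx.to_comp.comp Computable.fst))
      (Computable.encode.comp (Computable.pair ?_ Computable.snd))) ?_
    · exact (Primrec.list_drop.comp (Primrec.succ.comp (hidx.comp Primrec.fst)) Primrec.fst).to_comp
    · exact (Computable.ofOption (Computable.decode.comp Computable.snd)).to₂
  · obtain ⟨c, hc⟩ := Nat.Partrec.Code.exists_code.1 hT
    refine ⟨Encodable.encode c + 1, fun p y x hx =>
      ⟨List.replicate (Encodable.encode c) true ++ false :: p, by simp; omega, ?_⟩⟩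
    have h1 : (List.replicate (Encodable.encode c) true ++ false :: p).findIdx not
        = Encodable.encode c := by
      have h2 : ∀ k : ℕ, (List.replicate k true ++ false :: p).findIdx not = k := by
        intro k
        induction k with
        | zero => simp [List.findIdx_cons]
        | succ k ih => simp [List.replicate_succ, List.findIdx_cons, ih]
      exact h2 _
    simp only [standardMachine, h1, Denumerable.ofNat_encode, hc]
    simp [List.drop_append, hx]

/-! ### Random labeled graphs -/

open Classical in
/-- The code `E(G)` of a labeled graph: the `n(n-1)/2` possible edges `{u, v}`, `u < v`, are
listed in lexicographic order, and each contributes one bit telling whether it is present. -/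
noncomputable def edgeCode {n : ℕ} (G : SimpleGraph (Fin n)) : List Bool :=
  (List.finRange n).flatMap fun u =>
    ((List.finRange n).filter fun v => u < v).map fun v => decide (G.Adj u v)

/-- The labeled graph `G` on `n` nodes is `δ(n)`-random:
`C(E(G) | n, δ) ≥ n(n-1)/2 - δ(n)`, where `n(n-1)/2` is the logarithm of the number of labeled
graphs on `n` nodes. The number `d` is the finite object (a program, the value `δ(n)`, ...) by
which `δ` is presented in the condition. -/
def IsRandomGraph (U : Machine) (δ : ℕ → ℝ) (d : ℕ) {n : ℕ} (G : SimpleGraph (Fin n)) : Prop :=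
  (n : ℝ) * ((n : ℝ) - 1) / 2 - δ n ≤ (condComplexity U (edgeCode G) (Nat.pair n d) : ℝ)

/-! ### Routing -/

/-- `Delivers G F w k x`: following the local routing functions `F`, a message with destination
`w` that is currently at node `x` travels along edges of `G` and arrives at `w` after exactly
`k` steps. Here `F x w` is the neighbour to which node `x` forwards messages for `w`. -/
inductive Delivers {n : ℕ} (G : SimpleGraph (Fin n)) (F : Fin n → Fin n → Fin n) (w : Fin n) :
    ℕ → Fin n → Prop
  | arrive : Delivers G F w 0 w
  | step {k : ℕ} {x : Fin n} : x ≠ w → G.Adj x (F x w) → Delivers G F w k (F x w) →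
      Delivers G F w (k + 1) x

/-- The routing scheme `F` (a local routing function `F u` for every node `u`) is a shortest path
routing scheme for `G`: the route from `u` to `w` has length equal to the distance, for all nodes
`u`, `w` joined by a path. -/
def IsShortestPathScheme {n : ℕ} (G : SimpleGraph (Fin n)) (F : Fin n → Fin n → Fin n) : Prop :=
  ∀ u w : Fin n, G.Reachable u w → Delivers G F w (G.dist u w) u

open Classical in
/-- The labels of the neighbours of `u`, in increasing order. -/
noncomputable def neighbourLabels {n : ℕ} (G : SimpleGraph (Fin n)) (u : Fin n) : List ℕ :=
  ((List.finRange n).filter fun v => G.Adj u v).map fun v => (v : ℕ)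

/-- An interpreter for stored local routing functions. Its arguments are the stored bits and,
free of charge, the number of nodes, the own label of the node, the labels of the neighbours, and
the destination label. The result is the label of the neighbour to forward to. -/
abbrev Interpreter : Type := List Bool → ℕ × ℕ × List ℕ × ℕ →. ℕ

/-- With no relabeling and neighbours known, the bit string `s` stored at node `u` represents the
local routing function `f` of `u`: from `s`, `n`, `u` and the neighbours of `u`, the interpreter
computes `f w` for each destination `w ≠ u` that can be reached from `u`. -/
def Stores (D : Interpreter) {n : ℕ} (G : SimpleGraph (Fin n)) (u : Fin n) (s : List Bool)
    (f : Fin n → Fin n) : Prop :=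
  ∀ w : Fin n, w ≠ u → G.Reachable u w →
    (f w : ℕ) ∈ D s (n, (u : ℕ), neighbourLabels G u, (w : ℕ))

end CompactRouting

/-!
A recursively enumerable family that contains only a fraction `2 ^ (-Ω(n))` of the labeled graphs
on `n` nodes contains no `o(n)`-random graph for large `n`: a member is described by its index in
an enumeration of the family, which saves `Ω(n)` bits. Three families of this kind are used. The
first two show that in a random graph all degrees are at most `n / 2 + o(n)`, and any two nodes
have a common neighbour. Hence a nonneighbour `w` of `u` is at distance two, and shortest path
routing forwards messages from `u` to `w` through a common neighbour `v`. Given the neighbourhood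
of `u`, the string stored at `u` thus determines an edge `vw` for each of the about `n / 2`
nonneighbours `w`, and these edges are distinct. So if the string were shorter than `n / 2` by
`Ω(n)` bits, the graph would belong to a third such family.
-/

namespace CompactRouting

open Encodable Filter

/-! ### Recursively enumerable predicates -/

section RecursivelyEnumerable

variable {α β : Type*} [Primcodable α] [Primcodable β]

theorem rePred_of_primrecPred {p : α → Prop} (hp : PrimrecPred p) : REPred p :=
  hp.computablePred.to_re

theorem rePred_comp {p : β → Prop} (hp : REPred p) {f : α → β} (hf : Computable f) :
    REPred fun a => p (f a) :=
  Partrec.comp hp hf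

/-- A monotone sequence of primitive recursive approximations makes `∀ i < n` commute with the
search for a stage. -/
theorem exists_primrec_stages {p : α → Prop} (hp : REPred p) :
    ∃ R : α → ℕ → Prop, PrimrecRel R ∧ (∀ a, Monotone (R a)) ∧ ∀ a, p a ↔ ∃ t, R a t := by
  obtain ⟨c, hc⟩ := Nat.Partrec.Code.exists_code.1 hp
  refine ⟨fun a t => (Nat.Partrec.Code.evaln t c (encode a)).isSome, ?_, ?_, fun a => ?_⟩
  · exact Primrec.eq.comp (Primrec.option_isSome.comp (Nat.Partrec.Code.primrec_evaln.comp
      ((Primrec.snd.pair (Primrec.const c)).pair (Primrec.encode.comp Primrec.fst))))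
      (Primrec.const true)
  · intro a t t' htt ht
    obtain ⟨x, hx⟩ := Option.isSome_iff_exists.1 ht
    exact Option.isSome_iff_exists.2 ⟨x, Nat.Partrec.Code.evaln_mono htt hx⟩
  · have hdom : p a ↔ ∃ x, x ∈ Nat.Partrec.Code.eval c (encode a) := by
      simp [hc]
    simp only [hdom, Nat.Partrec.Code.evaln_complete, Option.isSome_iff_exists, Option.mem_def]
    exact exists_comm

theorem rePred_of_exists {R : α → β → Prop} (hR : PrimrecRel R) : REPred fun a => ∃ b, R a b := by
  classical
  refine (Partrec.rfindOpt (f := fun a i => (decode i : Option β).bind fun b =>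
    if R a b then some b else none) (Primrec.to_comp ?_)).dom_re.of_eq fun a => ?_
  · exact Primrec.option_bind (Primrec.decode.comp Primrec.snd) (Primrec.ite
      (hR.comp (Primrec.fst.comp Primrec.fst) Primrec.snd)
      (Primrec.option_some.comp Primrec.snd) (Primrec.const none)).to₂
  · rw [Nat.rfindOpt_dom]
    constructor
    · rintro ⟨i, b, hb⟩
      obtain ⟨b', -, hb'⟩ := Option.bind_eq_some_iff.1 hb
      exact ⟨b', (Option.ite_none_right_eq_some.1 hb').1⟩
    · rintro ⟨b, hb⟩
      exact ⟨encode b, b, by simp [hb]⟩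

theorem rePred_and {p q : α → Prop} (hp : REPred p) (hq : REPred q) :
    REPred fun a => p a ∧ q a :=
  (Partrec.bind hp (Partrec.comp hq Computable.fst).to₂).dom_re.of_eq fun a => by
    simp [Part.assert]

theorem rePred_or {p q : α → Prop} (hp : REPred p) (hq : REPred q) :
    REPred fun a => p a ∨ q a := by
  obtain ⟨R, hR, -, hpR⟩ := exists_primrec_stages hp
  obtain ⟨S, hS, -, hqS⟩ := exists_primrec_stages hq
  exact (rePred_of_exists (R := fun a t => R a t ∨ S a t) (hR.or hS)).of_eq fun a => by
    rw [hpR, hqS, exists_or]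

theorem rePred_exists {p : α → β → Prop} (hp : REPred fun q : α × β => p q.1 q.2) :
    REPred fun a => ∃ b, p a b := by
  obtain ⟨R, hR, -, hpR⟩ := exists_primrec_stages hp
  refine (rePred_of_exists (β := β × ℕ) (R := fun a w => R (a, w.1) w.2) ?_).of_eq fun a => ?_
  · exact hR.comp (Primrec.fst.pair (Primrec.fst.comp Primrec.snd))
      (Primrec.snd.comp Primrec.snd)
  · simp only [Prod.exists, ← hpR]

theorem rePred_forall_lt {p : α → ℕ → Prop} (hp : REPred fun q : α × ℕ => p q.1 q.2) {f : α → ℕ}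
    (hf : Primrec f) : REPred fun a => ∀ i < f a, p a i := by
  obtain ⟨R, hR, hmono, hpR⟩ := exists_primrec_stages hp
  refine (rePred_of_exists (β := ℕ) (R := fun a t => ∀ i < f a, R (a, i) t) ?_).of_eq fun a => ?_
  · have hRi : PrimrecRel fun i (q : α × ℕ) => R (q.1, i) q.2 :=
      hR.comp ((Primrec.fst.comp Primrec.snd).pair Primrec.fst) (Primrec.snd.comp Primrec.snd)
    exact (hRi.forall_mem_list.comp (Primrec.list_range.comp (hf.comp Primrec.fst))
      Primrec.id).of_eq fun q => by simp
  · refine ⟨fun ⟨t, ht⟩ i hi => (hpR (a, i)).2 ⟨t, ht i hi⟩, fun h => ?_⟩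
    choose t ht using fun i : Fin (f a) => (hpR (a, i)).1 (h i i.2)
    exact ⟨Finset.univ.sup t, fun i hi =>
      hmono _ (Finset.le_sup (Finset.mem_univ (⟨i, hi⟩ : Fin (f a)))) (ht ⟨i, hi⟩)⟩

theorem rePred_mem {f : α →. β} (hf : Partrec f) {g : α → β} (hg : Computable g) :
    REPred fun a => g a ∈ f a := by
  classical
  refine (Partrec.bind hf (Partrec.comp (rePred_of_primrecPred (Primrec.eq (α := β)))
    ((hg.comp Computable.fst).pair Computable.snd)).to₂).dom_re.of_eq fun a => ?_
  simp [Part.dom_iff_mem]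

end RecursivelyEnumerable

/-! ### Complexity of the members of an enumerable set -/

/-- The number with binary expansion `p`, least significant bit first. Leading zeros are allowed,
so a program need not have the exact length of the number it stands for. -/
def bitsToNat (p : List Bool) : ℕ := p.foldr Nat.bit 0

theorem bitsToNat_bits (m : ℕ) : bitsToNat m.bits = m := by
  induction m using Nat.binaryRec' with
  | zero => rfl
  | bit b m h ih => rw [Nat.bits_append_bit m b h, bitsToNat, List.foldr_cons, ← bitsToNat, ih]

theorem primrec_bitsToNat : Primrec bitsToNat := by
  refine Primrec.list_foldr (h := fun _ q => Nat.bit q.1 q.2) Primrec.id (Primrec.const 0) ?_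
  exact Primrec.cond (Primrec.fst.comp Primrec.snd)
    (Primrec.nat_double_succ.comp (Primrec.snd.comp Primrec.snd))
    (Primrec.nat_double.comp (Primrec.snd.comp Primrec.snd))

section PrimrecList

variable {α : Type*} [Primcodable α]

theorem primrecRel_mem_list : PrimrecRel fun (l : List α) (x : α) => x ∈ l :=
  (PrimrecRel.exists_mem_list Primrec.eq).of_eq fun l x => by simp

theorem primrec_list_union [DecidableEq α] : Primrec₂ fun l m : List α => l ∪ m := by
  have hinsert : Primrec fun q : α × List α => List.insert q.1 q.2 :=
    (Primrec.ite (primrecRel_mem_list.comp Primrec.snd Primrec.fst) Primrec.snd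
      (Primrec.list_cons.comp Primrec.fst Primrec.snd)).of_eq fun q => by simp [List.insert]
  exact Primrec.list_foldr (h := fun _ q => List.insert q.1 q.2) Primrec.fst Primrec.snd
    (hinsert.comp Primrec.snd)

theorem primrec_option_toList : Primrec (Option.toList : Option α → List α) :=
  (Primrec.option_casesOn (g := fun _ x => [x]) Primrec.id (Primrec.const [])
    (Primrec.list_cons.comp Primrec.snd (Primrec.const []))).of_eq fun o => by cases o <;> rfl

end PrimrecList

section Enumeration

variable {σ : Type*} [Primcodable σ]

section FoundValues

variable {α : Type*} [DecidableEq α] {h : ℕ → σ → Option α}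

variable (h) in
/-- The distinct values of `h n` at the first `j` arguments, the most recently found first. -/
def foundValues (n : ℕ) : ℕ → List α
  | 0 => []
  | j + 1 => ((decode j).bind (h n)).toList ∪ foundValues n j

theorem primrec_foundValues [Primcodable α] (hh : Primrec₂ h) : Primrec₂ (foundValues h) := by
  have hnext : Primrec fun r : ℕ × ℕ × List α => (decode r.2.1).bind (h r.1) :=
    Primrec.option_bind (Primrec.decode.comp (Primrec.fst.comp Primrec.snd))
      (hh.comp (Primrec.fst.comp Primrec.fst) Primrec.snd).to₂
  refine (Primrec.nat_rec (g := fun n q => ((decode q.1).bind (h n)).toList ∪ q.2)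
    (Primrec.const []) (primrec_list_union.comp (primrec_option_toList.comp hnext)
      (Primrec.snd.comp Primrec.snd)).to₂).of_eq fun n j => ?_
  induction j with
  | zero => rfl
  | succ j ih => simp only [foundValues, ← ih]

theorem foundValues_suffix (n : ℕ) {i j : ℕ} (hij : i ≤ j) :
    foundValues h n i <:+ foundValues h n j := by
  induction hij with
  | refl => exact List.suffix_refl _
  | @step j _ ih => exact ih.trans (List.suffix_union_right ((decode j).bind (h n)).toList _)

theorem nodup_foundValues (n j : ℕ) : (foundValues h n j).Nodup := by
  induction j with
  | zero => exact List.nodup_nil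
  | succ j ih => exact ih.union _

theorem exists_of_mem_foundValues {n j : ℕ} {x : α} (hx : x ∈ foundValues h n j) :
    ∃ a, h n a = some x := by
  induction j with
  | zero => exact absurd hx List.not_mem_nil
  | succ j ih =>
    rcases List.mem_union_iff.1 hx with hx | hx
    · obtain ⟨a, -, ha⟩ := Option.bind_eq_some_iff.1 (Option.mem_toList.1 hx)
      exact ⟨a, ha⟩
    · exact ih hx

theorem mem_foundValues {n : ℕ} {a : σ} {x : α} (ha : h n a = some x) :
    x ∈ foundValues h n (encode a + 1) :=
  List.mem_union_iff.2 (Or.inl (by simp [ha]))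

end FoundValues

variable {h : ℕ → σ → Option (List Bool)}

variable (h) in
/-- The machine that reads its program as an index into the enumeration of the values of `h n`,
where `n` is the first component of the input. -/
def enumerationMachine : Machine := fun p y =>
  Nat.rfindOpt fun j => (foundValues h y.unpair.1 j).reverse[bitsToNat p]?

theorem partrec_enumerationMachine (hh : Primrec₂ h) : Partrec₂ (enumerationMachine h) := by
  refine Partrec.rfindOpt (f := fun (q : List Bool × ℕ) j =>
    (foundValues h q.2.unpair.1 j).reverse[bitsToNat q.1]?) (Primrec.to_comp ?_)
  refine Primrec.list_getElem?.comp (Primrec.list_reverse.comp ((primrec_foundValues hh).comp ?_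
    Primrec.snd)) (primrec_bitsToNat.comp (Primrec.fst.comp Primrec.fst))
  exact Primrec.fst.comp (Primrec.unpair.comp (Primrec.snd.comp Primrec.fst))

theorem mem_enumerationMachine {p : List Bool} {n d j : ℕ} {x : List Bool}
    (hx : (foundValues h n j).reverse[bitsToNat p]? = some x) :
    x ∈ enumerationMachine h p (Nat.pair n d) := by
  refine (Nat.rfindOpt_mono fun {y i j} hij hy => ?_).2 ⟨j, by simpa using hx⟩
  obtain ⟨t, ht⟩ := (foundValues_suffix (h := h) _ hij).reverse
  rw [Option.mem_def, ← ht, List.getElem?_append_left (List.getElem?_eq_some_iff.1 hy).1]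
  exact hy

theorem condComplexity_le_of_enumeration {U : Machine} (hU : IsUniversal U) (hh : Primrec₂ h) :
    ∃ c : ℕ, ∀ (n d k : ℕ) (S : Finset (List Bool)), (∀ a x, h n a = some x → x ∈ S) →
      S.card ≤ 2 ^ k → ∀ a x, h n a = some x → condComplexity U x (Nat.pair n d) ≤ k + c := by
  obtain ⟨c, hc⟩ := hU.2 _ (partrec_enumerationMachine hh)
  refine ⟨c, fun n d k S hS hk a x hx => ?_⟩
  set found := foundValues h n (encode a + 1)
  obtain ⟨i, hi, hix⟩ := List.getElem_of_mem (List.mem_reverse.2 (mem_foundValues hx))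
  have hlen : found.length ≤ 2 ^ k := by
    rw [← List.toFinset_card_of_nodup (nodup_foundValues n _)]
    refine (Finset.card_le_card fun y hy => ?_).trans hk
    obtain ⟨b, hb⟩ := exists_of_mem_foundValues (List.mem_toFinset.1 hy)
    exact hS b y hb
  have hbits : i.bits.length ≤ k := by
    rw [Nat.size_eq_bits_len, Nat.size_le]
    exact (hi.trans_eq List.length_reverse).trans_le hlen
  obtain ⟨q, hq, hqx⟩ := hc i.bits (Nat.pair n d) x (mem_enumerationMachine
    (by rw [bitsToNat_bits, List.getElem?_eq_getElem hi, hix]))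
  have hle : condComplexity U x (Nat.pair n d) ≤ q.length := Nat.sInf_le ⟨q, rfl, hqx⟩
  exact hle.trans (hq.trans (Nat.add_le_add_right hbits c))

theorem condComplexity_le_of_rePred {U : Machine} (hU : IsUniversal U) {R : ℕ × List Bool → Prop}
    (hR : REPred R) :
    ∃ c : ℕ, ∀ (n d k : ℕ) (S : Finset (List Bool)), (∀ x, R (n, x) → x ∈ S) →
      S.card ≤ 2 ^ k → ∀ x, R (n, x) → condComplexity U x (Nat.pair n d) ≤ k + c := by
  classical
  obtain ⟨Q, hQ, -, hRQ⟩ := exists_primrec_stages hR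
  have hprim : Primrec₂ fun n (w : List Bool × ℕ) => if Q (n, w.1) w.2 then some w.1 else none :=
    Primrec.ite (hQ.comp (Primrec.fst.pair (Primrec.fst.comp Primrec.snd))
      (Primrec.snd.comp Primrec.snd))
      (Primrec.option_some.comp (Primrec.fst.comp Primrec.snd)) (Primrec.const none)
  obtain ⟨c, hc⟩ := condComplexity_le_of_enumeration hU hprim
  refine ⟨c, fun n d k S hS hk x hx => ?_⟩
  obtain ⟨t, ht⟩ := (hRQ _).1 hx
  refine hc n d k S (fun w y hw => ?_) hk (x, t) x (if_pos ht)
  obtain ⟨hQw, hwy⟩ := Option.ite_none_right_eq_some.1 hw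
  exact Option.some.inj hwy ▸ hS _ ((hRQ _).2 ⟨_, hQw⟩)

end Enumeration

/-! ### Recursively enumerable families of graphs -/

/-- The graph on the natural numbers with the list of edges `a`. Through `graphOfEdges` it makes
labeled graphs available to computability statements, which need a `Primcodable` type. -/
def edgeListGraph (a : List (ℕ × ℕ)) : SimpleGraph ℕ := .fromRel fun u v => (u, v) ∈ a

/-- The labeled graph on `n` nodes with the list of edges `a`; entries of `a` that are loops or
mention labels beyond `n` are ignored. -/
def graphOfEdges (n : ℕ) (a : List (ℕ × ℕ)) : SimpleGraph (Fin n) :=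
  (edgeListGraph a).comap Fin.val

theorem exists_graphOfEdges_eq {n : ℕ} (G : SimpleGraph (Fin n)) : ∃ a, graphOfEdges n a = G := by
  classical
  let edges : List (Fin n × Fin n) := (Finset.univ.filter fun e => G.Adj e.1 e.2).toList
  refine ⟨edges.map (Prod.map Fin.val Fin.val), ?_⟩
  ext u v
  have hmem (u v : Fin n) : ((u : ℕ), (v : ℕ)) ∈ edges.map (Prod.map Fin.val Fin.val) ↔
      G.Adj u v := by
    simp [edges, Fin.val_inj]
  rw [graphOfEdges, SimpleGraph.comap_adj, edgeListGraph, SimpleGraph.fromRel_adj, hmem, hmem,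
    G.adj_comm v u, or_self, Fin.val_ne_iff]
  exact and_iff_right_of_imp SimpleGraph.Adj.ne

theorem primrecPred_adj {α : Type*} [Primcodable α] {a : α → List (ℕ × ℕ)} {u v : α → ℕ}
    (ha : Primrec a) (hu : Primrec u) (hv : Primrec v) :
    PrimrecPred fun x => (edgeListGraph (a x)).Adj (u x) (v x) :=
  (Primrec.eq.comp hu hv).not.and
    ((primrecRel_mem_list.comp ha (hu.pair hv)).or (primrecRel_mem_list.comp ha (hv.pair hu)))

theorem primrec_edgeCode_graphOfEdges : Primrec₂ fun n a => edgeCode (graphOfEdges n a) := by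
  classical
  have hlater : Primrec fun q : (ℕ × List (ℕ × ℕ)) × ℕ =>
      (List.range q.1.1).filter fun v => q.2 < v :=
    (PrimrecRel.listFilter (R := fun v u : ℕ => u < v) Primrec.nat_lt.swap).comp
      (Primrec.list_range.comp (Primrec.fst.comp Primrec.fst)) Primrec.snd
  have hbit : Primrec₂ fun (q : (ℕ × List (ℕ × ℕ)) × ℕ) v =>
      decide ((edgeListGraph q.1.2).Adj q.2 v) :=
    (primrecPred_adj (Primrec.snd.comp (Primrec.fst.comp Primrec.fst))
      (Primrec.snd.comp Primrec.fst) Primrec.snd).decide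
  refine (Primrec.list_flatMap (Primrec.list_range.comp Primrec.fst)
    (Primrec.list_map hlater hbit).to₂).of_eq fun ⟨n, a⟩ => ?_
  simp only [edgeCode, ← List.map_coe_finRange_eq_range, List.flatMap_map, List.filter_map,
    List.map_map]
  rfl

open Classical in
/-- The coercion in `neighbourLabels` elaborates to a monadic lift of the whole list. -/
theorem neighbourLabels_eq_map {n : ℕ} (G : SimpleGraph (Fin n)) (u : Fin n) :
    neighbourLabels G u = ((List.finRange n).filter fun v => G.Adj u v).map Fin.val := by
  simp [neighbourLabels, ← List.map_eq_flatMap]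

open Classical in
/-- The counterpart of `neighbourLabels` for a graph given by a list of edges. -/
noncomputable def neighbourLabelsOfEdges (n : ℕ) (a : List (ℕ × ℕ)) (u : ℕ) : List ℕ :=
  (List.range n).filter fun v => (edgeListGraph a).Adj u v

theorem neighbourLabels_graphOfEdges (n : ℕ) (a : List (ℕ × ℕ)) (u : Fin n) :
    neighbourLabels (graphOfEdges n a) u = neighbourLabelsOfEdges n a u := by
  rw [neighbourLabels_eq_map, neighbourLabelsOfEdges, ← List.map_coe_finRange_eq_range,
    List.filter_map]
  rfl

theorem primrec_neighbourLabelsOfEdges {α : Type*} [Primcodable α] {n u : α → ℕ}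
    {a : α → List (ℕ × ℕ)} (hn : Primrec n) (ha : Primrec a) (hu : Primrec u) :
    Primrec fun x => neighbourLabelsOfEdges (n x) (a x) (u x) := by
  classical
  have hadj : PrimrecRel fun (v : ℕ) (x : α) => (edgeListGraph (a x)).Adj (u x) v :=
    primrecPred_adj (ha.comp Primrec.snd) (hu.comp Primrec.snd) Primrec.fst
  exact hadj.listFilter.comp (Primrec.list_range.comp hn) Primrec.id

theorem length_neighbourLabels {n : ℕ} (G : SimpleGraph (Fin n)) (u : Fin n)
    [Fintype (G.neighborSet u)] : (neighbourLabels G u).length = G.degree u := by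
  classical
  rw [neighbourLabels_eq_map, List.length_map, ← List.toFinset_card_of_nodup
    ((List.nodup_finRange n).filter _), ← G.card_neighborFinset_eq_degree]
  congr 1
  ext v
  simp

/-- A family of labeled graphs is recursively enumerable if membership is so for graphs presented
by the number of nodes and a list of edges. -/
def IsREFamily (𝓢 : ∀ n, Set (SimpleGraph (Fin n))) : Prop :=
  REPred fun q : ℕ × List (ℕ × ℕ) => graphOfEdges q.1 q.2 ∈ 𝓢 q.1

theorem condComplexity_edgeCode_le {U : Machine} (hU : IsUniversal U)
    {𝓢 : ∀ n, Set (SimpleGraph (Fin n))} (h𝓢 : IsREFamily 𝓢) :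
    ∃ c : ℕ, ∀ n d k, (𝓢 n).ncard ≤ 2 ^ k → ∀ G ∈ 𝓢 n,
      condComplexity U (edgeCode G) (Nat.pair n d) ≤ k + c := by
  classical
  have hcodes : REPred fun q : ℕ × List Bool =>
      ∃ a, graphOfEdges q.1 a ∈ 𝓢 q.1 ∧ edgeCode (graphOfEdges q.1 a) = q.2 := by
    have hn : Primrec fun r : (ℕ × List Bool) × List (ℕ × ℕ) => r.1.1 :=
      Primrec.fst.comp Primrec.fst
    exact rePred_exists (rePred_and (rePred_comp h𝓢 (hn.pair Primrec.snd).to_comp)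
      (rePred_of_primrecPred (Primrec.eq.comp (primrec_edgeCode_graphOfEdges.comp hn Primrec.snd)
        (Primrec.snd.comp Primrec.fst))))
  obtain ⟨c, hc⟩ := condComplexity_le_of_rePred hU hcodes
  refine ⟨c, fun n d k hk G hG => ?_⟩
  obtain ⟨a, rfl⟩ := exists_graphOfEdges_eq G
  refine hc n d k ((𝓢 n).toFinite.toFinset.image edgeCode) ?_ ?_ _ ⟨a, hG, rfl⟩
  · rintro x ⟨b, hb, hbx⟩
    exact Finset.mem_image.2 ⟨_, (𝓢 n).toFinite.mem_toFinset.2 hb, hbx⟩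
  · rw [Set.ncard_eq_toFinset_card] at hk
    exact Finset.card_image_le.trans hk

/-! ### Random graphs avoid exponentially rare families -/

/-- A family of labeled graphs is exponentially rare if the fraction of the `2 ^ (n choose 2)`
graphs on `n` nodes that belong to it is eventually at most `r ^ n` for some `r < 1`. -/
def IsExponentiallyRare (𝓢 : ∀ n, Set (SimpleGraph (Fin n))) : Prop :=
  ∃ r : ℝ, 0 < r ∧ r < 1 ∧ ∀ᶠ n : ℕ in atTop, ((𝓢 n).ncard : ℝ) ≤ 2 ^ n.choose 2 * r ^ n

theorem isExponentiallyRare_of_ncard_le {𝓢 : ∀ n, Set (SimpleGraph (Fin n))} (C : ℝ) (k : ℕ)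
    {r : ℝ} (hr₀ : 0 ≤ r) (hr : r < 1)
    (h : ∀ n, ((𝓢 n).ncard : ℝ) ≤ C * n ^ k * 2 ^ n.choose 2 * r ^ n) :
    IsExponentiallyRare 𝓢 := by
  obtain ⟨q, hrq, hq⟩ := exists_between hr
  have hq₀ : 0 < q := hr₀.trans_lt hrq
  refine ⟨q, hq₀, hq, ?_⟩
  have hlittle : (fun n : ℕ => C * ((n : ℝ) ^ k * r ^ n)) =o[atTop] fun n : ℕ => q ^ n :=
    (isLittleO_pow_const_mul_const_pow_const_pow_of_norm_lt k
      (by rwa [Real.norm_of_nonneg hr₀])).const_mul_left C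
  filter_upwards [hlittle.bound one_pos] with n hn
  rw [Real.norm_of_nonneg (pow_nonneg hq₀.le n), one_mul] at hn
  calc ((𝓢 n).ncard : ℝ) ≤ 2 ^ n.choose 2 * (C * (n ^ k * r ^ n)) := (h n).trans_eq (by ring)
    _ ≤ 2 ^ n.choose 2 * q ^ n := by gcongr; exact (le_abs_self _).trans hn

theorem IsExponentiallyRare.exists_ncard_mul_le {𝓢 : ∀ n, Set (SimpleGraph (Fin n))}
    (h : IsExponentiallyRare 𝓢) :
    ∃ m : ℕ, 0 < m ∧ ∀ᶠ n in atTop, (𝓢 n).ncard * 2 ^ (n / m) ≤ 2 ^ n.choose 2 := by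
  obtain ⟨r, hr₀, hr, hcard⟩ := h
  obtain ⟨m, hm⟩ := exists_pow_lt_of_lt_one (one_half_pos (α := ℝ)) hr
  have hm₀ : m ≠ 0 := by
    rintro rfl
    norm_num at hm
  refine ⟨m, Nat.pos_of_ne_zero hm₀, ?_⟩
  filter_upwards [hcard] with n hn
  have hpow : r ^ n ≤ (1 / 2) ^ (n / m) :=
    calc r ^ n ≤ r ^ (m * (n / m)) := pow_le_pow_of_le_one hr₀.le hr.le (Nat.mul_div_le n m)
      _ = (r ^ m) ^ (n / m) := pow_mul r m _
      _ ≤ (1 / 2) ^ (n / m) := pow_le_pow_left₀ (pow_nonneg hr₀.le m) hm.le _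
  have hreal : ((𝓢 n).ncard : ℝ) * 2 ^ (n / m) ≤ 2 ^ n.choose 2 :=
    calc ((𝓢 n).ncard : ℝ) * 2 ^ (n / m)
        ≤ 2 ^ n.choose 2 * (1 / 2) ^ (n / m) * 2 ^ (n / m) := by gcongr; exact hn.trans (by gcongr)
      _ = 2 ^ n.choose 2 := by rw [mul_assoc, ← mul_pow]; norm_num
  exact_mod_cast hreal

theorem eventually_notMem_of_isRandomGraph {U : Machine} (hU : IsUniversal U) {δ : ℕ → ℝ}
    (hδ : δ =o[atTop] fun n : ℕ => (n : ℝ)) {𝓢 : ∀ n, Set (SimpleGraph (Fin n))}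
    (hre : IsREFamily 𝓢) (hrare : IsExponentiallyRare 𝓢) :
    ∀ᶠ n : ℕ in atTop, ∀ (d : ℕ) (G : SimpleGraph (Fin n)), IsRandomGraph U δ d G → G ∉ 𝓢 n := by
  obtain ⟨c, hc⟩ := condComplexity_edgeCode_le hU hre
  obtain ⟨m, hm, hcard⟩ := hrare.exists_ncard_mul_le
  have hm' : (0 : ℝ) < m := Nat.cast_pos.2 hm
  have hδm : ∀ᶠ n : ℕ in atTop, ‖δ n‖ ≤ 1 / (2 * m) * ‖(n : ℝ)‖ := hδ.bound (by positivity)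
  filter_upwards [hcard, hδm, eventually_gt_atTop (2 * m * (c + 1))]
    with n hn hδn hlarge d G hG hmem
  have hdiv : n / m ≤ n.choose 2 := by
    have hpos : 0 < (𝓢 n).ncard := (Set.ncard_pos).2 ⟨G, hmem⟩
    exact (Nat.pow_le_pow_iff_right one_lt_two).1 ((Nat.le_mul_of_pos_left _ hpos).trans hn)
  have hcompressed : condComplexity U (edgeCode G) (Nat.pair n d) ≤ n.choose 2 - n / m + c := by
    refine hc n d _ (Nat.le_of_mul_le_mul_right ?_ (Nat.two_pow_pos (n / m))) G hmem
    rwa [← pow_add, Nat.sub_add_cancel hdiv]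
  have hsaved : ((n / m : ℕ) : ℝ) ≤ c + δ n := by
    have hreal : (condComplexity U (edgeCode G) (Nat.pair n d) : ℝ) + (n / m : ℕ) ≤
        n * (n - 1) / 2 + c := by
      rw [← Nat.cast_choose_two]
      exact_mod_cast (by omega)
    have hrandom : (n : ℝ) * (n - 1) / 2 - δ n ≤ condComplexity U (edgeCode G) (Nat.pair n d) := hG
    linarith
  have hfloor : (n : ℝ) / m < (n / m : ℕ) + 1 := by
    rw [div_lt_iff₀ hm']
    exact_mod_cast Nat.lt_mul_of_div_lt (Nat.lt_succ_self _) hm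
  have hlarge' : (c : ℝ) + 1 < n / (2 * m) := by
    rw [lt_div_iff₀ (by positivity)]
    exact_mod_cast (mul_comm _ _).trans_lt hlarge
  have hhalf : δ n ≤ n / (2 * m) := by
    refine (le_abs_self _).trans (hδn.trans_eq ?_)
    rw [Real.norm_natCast, one_div_mul_eq_div]
  have htwice : (n : ℝ) / m = n / (2 * m) + n / (2 * m) := by field_simp; norm_num
  linarith


/-! ### Counting graphs with prescribed pairs -/

section Counting

open Finset

variable {V : Type*} [Fintype V]

theorem ncard_mul_two_pow_le_of_agree {𝓑 : Set (SimpleGraph V)} {E : Finset (Sym2 V)}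
    (hE : ∀ e ∈ E, ¬e.IsDiag) {S : Set (Sym2 V)}
    (hS : ∀ G ∈ 𝓑, ∀ e ∈ E, (e ∈ G.edgeSet ↔ e ∈ S)) :
    𝓑.ncard * 2 ^ #E ≤ 2 ^ (Fintype.card V).choose 2 := by
  classical
  have hE' : E ⊆ (⊤ : SimpleGraph V).edgeFinset := fun e he => by simpa using hE e he
  have hinj : Set.InjOn (fun G : SimpleGraph V => G.edgeFinset \ E) 𝓑 := by
    intro G hG H hH hGH
    refine SimpleGraph.edgeSet_inj.1 (Set.ext fun e => ?_)
    by_cases he : e ∈ E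
    · rw [hS G hG e he, hS H hH e he]
    · simpa [he] using Finset.ext_iff.1 hGH e
  have hmaps : ∀ G ∈ 𝓑, G.edgeFinset \ E ∈
      (((⊤ : SimpleGraph V).edgeFinset \ E).powerset : Set (Finset (Sym2 V))) := fun G _ =>
    mem_coe.2 (mem_powerset.2 (sdiff_subset_sdiff (SimpleGraph.edgeFinset_mono le_top) le_rfl))
  have hcard : 𝓑.ncard ≤ 2 ^ ((Fintype.card V).choose 2 - #E) := by
    refine (Set.ncard_le_ncard_of_injOn _ hmaps hinj (finite_toSet _)).trans_eq ?_
    rw [Set.ncard_coe_finset, card_powerset, card_sdiff_of_subset hE',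
      SimpleGraph.card_edgeFinset_top_eq_card_choose_two]
  calc 𝓑.ncard * 2 ^ #E ≤ 2 ^ ((Fintype.card V).choose 2 - #E) * 2 ^ #E := by gcongr
    _ = 2 ^ (Fintype.card V).choose 2 := by
      rw [← pow_add, Nat.sub_add_cancel]
      exact (card_le_card hE').trans_eq SimpleGraph.card_edgeFinset_top_eq_card_choose_two

theorem ncard_mul_two_pow_le_of_neighborSet_eq {𝓑 : Set (SimpleGraph V)} {u : V} {A : Set V}
    (hA : ∀ G ∈ 𝓑, G.neighborSet u = A) {E : Finset (Sym2 V)}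
    (hE : ∀ e ∈ E, ¬e.IsDiag ∧ u ∉ e) {S : Set (Sym2 V)}
    (hS : ∀ G ∈ 𝓑, ∀ e ∈ E, (e ∈ G.edgeSet ↔ e ∈ S)) :
    𝓑.ncard * 2 ^ (Fintype.card V - 1 + #E) ≤ 2 ^ (Fintype.card V).choose 2 := by
  classical
  let star : Finset (Sym2 V) := (univ.erase u).image fun v => s(u, v)
  have hstar : ∀ e, e ∈ star ↔ ∃ v, v ≠ u ∧ s(u, v) = e := by simp [star]
  have hcard : #star = Fintype.card V - 1 := by
    rw [card_image_of_injective _ fun v w h => Sym2.congr_right.1 h, card_erase_of_mem (mem_univ u),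
      card_univ]
  have hdisj : Disjoint star E := disjoint_left.2 fun e he heE => by
    obtain ⟨v, -, rfl⟩ := (hstar e).1 he
    exact (hE _ heE).2 (Sym2.mem_mk_left u v)
  rw [← hcard, ← card_union_of_disjoint hdisj]
  refine ncard_mul_two_pow_le_of_agree (S := {e | ∃ v ∈ A, s(u, v) = e} ∪ (S ∩ {e | u ∉ e}))
    (fun e he => ?_) fun G hG e he => ?_
  · rcases mem_union.1 he with he | he
    · obtain ⟨v, hv, rfl⟩ := (hstar e).1 he
      exact hv.symm
    · exact (hE e he).1
  · rcases mem_union.1 he with he | he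
    · obtain ⟨v, -, rfl⟩ := (hstar e).1 he
      have hadj : s(u, v) ∈ G.edgeSet ↔ v ∈ A := by rw [← hA G hG]; rfl
      simp only [hadj, Set.mem_union, Set.mem_ofPred_eq, Sym2.congr_right, exists_eq_right,
        Set.mem_inter_iff, Sym2.mem_mk_left, not_true_eq_false, and_false, or_false]
    · rw [hS G hG e he]
      have hne : ∀ v, s(u, v) ≠ e := fun v h => (hE e he).2 (h ▸ Sym2.mem_mk_left u v)
      simp [hne, (hE e he).2]

/-- Summing over the neighbourhood `A` of `u`: each `A` accounts for the `card V - 1` pairs at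
`u`, and for `m A` further pairs whose status it determines. -/
theorem ncard_le_mul_sum_div {𝓑 : Set (SimpleGraph V)} {u : V} {𝓐 : Finset (Finset V)}
    {m : Finset V → ℕ}
    (h : ∀ G ∈ 𝓑, ∃ A ∈ 𝓐, G.neighborSet u = A ∧ ∃ E : Finset (Sym2 V), m A ≤ #E ∧
      (∀ e ∈ E, ¬e.IsDiag ∧ u ∉ e) ∧
      ∀ H ∈ 𝓑, H.neighborSet u = A → ∀ e ∈ E, (e ∈ H.edgeSet ↔ e ∈ G.edgeSet)) :
    (𝓑.ncard : ℝ) ≤ 2 ^ (Fintype.card V).choose 2 *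
      ((∑ A ∈ 𝓐, (1 / 2) ^ m A) / 2 ^ (Fintype.card V - 1)) := by
  let fiber (A : Finset V) : Set (SimpleGraph V) := {G ∈ 𝓑 | G.neighborSet u = A}
  have hfiber (A : Finset V) : ((fiber A).ncard : ℝ) * 2 ^ (Fintype.card V - 1) ≤
      2 ^ (Fintype.card V).choose 2 * (1 / 2) ^ m A := by
    rcases (fiber A).eq_empty_or_nonempty with hempty | ⟨G, hG, hGA⟩
    · rw [hempty, Set.ncard_empty, Nat.cast_zero, zero_mul]
      positivity
    · obtain ⟨B, -, hB, E, hmE, hE, hagree⟩ := h G hG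
      obtain rfl : A = B := coe_injective (hGA.symm.trans hB)
      have hcount := ncard_mul_two_pow_le_of_neighborSet_eq (𝓑 := fiber A)
        (fun H hH => hH.2) hE fun H hH => hagree H hH.1 hH.2
      rw [one_div_pow, mul_one_div, le_div_iff₀ (by positivity), mul_assoc, ← pow_add]
      calc ((fiber A).ncard : ℝ) * 2 ^ (Fintype.card V - 1 + m A)
          ≤ (fiber A).ncard * 2 ^ (Fintype.card V - 1 + #E) := by gcongr; exact one_le_two
        _ ≤ 2 ^ (Fintype.card V).choose 2 := by exact_mod_cast hcount
  have hcover : 𝓑 = ⋃ A ∈ 𝓐, fiber A := by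
    ext G
    simp only [Set.mem_iUnion, exists_prop]
    refine ⟨fun hG => ?_, fun ⟨_, _, hG, _⟩ => hG⟩
    obtain ⟨A, hA, hGA, -⟩ := h G hG
    exact ⟨A, hA, hG, hGA⟩
  have hunion : (𝓑.ncard : ℝ) ≤ ∑ A ∈ 𝓐, ((fiber A).ncard : ℝ) := by
    conv_lhs => rw [hcover]
    exact_mod_cast set_ncard_biUnion_le 𝓐 fiber
  rw [← mul_div_assoc, le_div_iff₀ (by positivity)]
  calc (𝓑.ncard : ℝ) * 2 ^ (Fintype.card V - 1)
      ≤ ∑ A ∈ 𝓐, ((fiber A).ncard : ℝ) * 2 ^ (Fintype.card V - 1) := by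
        rw [← sum_mul]
        gcongr
    _ ≤ 2 ^ (Fintype.card V).choose 2 * ∑ A ∈ 𝓐, (1 / 2) ^ m A := by
        rw [mul_sum]
        exact sum_le_sum fun A _ => hfiber A

theorem ncard_le_card_mul_of_subset_iUnion {α ι : Type*} [Finite α] [Fintype ι] {s : Set α}
    {t : ι → Set α} (hst : s ⊆ ⋃ i, t i) {M : ℝ} (hM : ∀ i, ((t i).ncard : ℝ) ≤ M) :
    (s.ncard : ℝ) ≤ Fintype.card ι * M :=
  calc (s.ncard : ℝ) ≤ ∑ i, ((t i).ncard : ℝ) := by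
        exact_mod_cast (Set.ncard_le_ncard hst).trans (Set.ncard_iUnion_le_of_fintype t)
    _ ≤ Fintype.card ι * M := by
        rw [← nsmul_eq_mul]
        exact sum_le_card_nsmul _ _ _ fun i _ => hM i

theorem sum_powerset_pow_card {ι : Type*} (s : Finset ι) (x : ℝ) :
    ∑ A ∈ s.powerset, x ^ #A = (x + 1) ^ #s := by
  simpa using sum_pow_mul_eq_add_pow x 1 s

/-- Markov's inequality for `exp (ε * (2 * #A - #s))`. -/
theorem card_large_subsets_le {ι : Type*} (s : Finset ι) {ε : ℝ} (hε : 0 ≤ ε) :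
    (#{A ∈ s.powerset | (1 + ε) * #s ≤ 2 * #A} : ℝ) ≤ 2 ^ #s * Real.exp (-(ε ^ 2 / 2)) ^ #s := by
  have hmgf : Real.exp (-ε) ^ #s * ∑ A ∈ s.powerset, Real.exp (2 * ε) ^ #A ≤
      2 ^ #s * Real.exp (ε ^ 2 / 2) ^ #s := by
    rw [sum_powerset_pow_card, ← mul_pow, ← mul_pow]
    refine pow_le_pow_left₀ (by positivity) ?_ _
    calc Real.exp (-ε) * (Real.exp (2 * ε) + 1) = 2 * Real.cosh ε := by
          rw [mul_add, ← Real.exp_add, mul_one, Real.cosh_eq]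
          ring_nf
      _ ≤ 2 * Real.exp (ε ^ 2 / 2) := by gcongr; exact Real.cosh_le_exp_half_sq ε
  have hmarkov : #{A ∈ s.powerset | (1 + ε) * #s ≤ 2 * #A} * Real.exp (ε ^ 2) ^ #s ≤
      Real.exp (-ε) ^ #s * ∑ A ∈ s.powerset, Real.exp (2 * ε) ^ #A := by
    rw [mul_sum, ← nsmul_eq_mul]
    refine (card_nsmul_le_sum _ _ _ fun A hA => ?_).trans
      (sum_le_sum_of_subset_of_nonneg (filter_subset _ _) fun A _ _ => by positivity)
    rw [← Real.exp_nat_mul, ← Real.exp_nat_mul, ← Real.exp_nat_mul, ← Real.exp_add]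
    refine Real.exp_le_exp.2 ?_
    nlinarith [mul_le_mul_of_nonneg_left (mem_filter.1 hA).2 hε]
  have hsplit : Real.exp (-(ε ^ 2 / 2)) ^ #s * Real.exp (ε ^ 2) ^ #s =
      Real.exp (ε ^ 2 / 2) ^ #s := by
    rw [← mul_pow, ← Real.exp_add]
    ring_nf
  refine le_of_mul_le_mul_right ?_ (by positivity : 0 < Real.exp (ε ^ 2) ^ #s)
  rw [mul_assoc, hsplit]
  exact hmarkov.trans hmgf

theorem neighborFinset_mem_powerset_erase [DecidableEq V] (G : SimpleGraph V) (u : V)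
    [Fintype (G.neighborSet u)] : G.neighborFinset u ∈ (univ.erase u).powerset :=
  mem_powerset.2 (subset_erase.2 ⟨subset_univ _, G.notMem_neighborFinset_self u⟩)

open Classical in
theorem ncard_degree_ge_le (u : V) {ε : ℝ} (hε : 0 ≤ ε) :
    ({G : SimpleGraph V | (1 + ε) * (Fintype.card V - 1 : ℕ) ≤ 2 * G.degree u}.ncard : ℝ) ≤
      2 ^ (Fintype.card V).choose 2 * Real.exp (-(ε ^ 2 / 2)) ^ (Fintype.card V - 1) := by
  let s := univ.erase u
  have hs : #s = Fintype.card V - 1 := by rw [card_erase_of_mem (mem_univ u), card_univ]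
  have hlarge := card_large_subsets_le s hε
  rw [hs] at hlarge
  refine (ncard_le_mul_sum_div (u := u) (m := fun _ => 0)
    (𝓐 := {A ∈ s.powerset | (1 + ε) * (Fintype.card V - 1 : ℕ) ≤ 2 * #A})
    fun G hG => ⟨G.neighborFinset u, mem_filter.2 ⟨neighborFinset_mem_powerset_erase G u, hG⟩,
      (G.coe_neighborFinset u).symm, ∅, by simp⟩).trans ?_
  simp only [pow_zero, sum_const, nsmul_eq_mul, mul_one]
  gcongr
  rw [div_le_iff₀' (by positivity)]
  exact hlarge

theorem ncard_no_common_neighbour_le {u w : V} (huw : u ≠ w) :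
    ({G : SimpleGraph V | ∀ v, ¬(G.Adj u v ∧ G.Adj v w)}.ncard : ℝ) ≤
      2 ^ (Fintype.card V).choose 2 * (2 * (3 / 4) ^ (Fintype.card V - 1)) := by
  classical
  let s := univ.erase u
  have hs : #s = Fintype.card V - 1 := by rw [card_erase_of_mem (mem_univ u), card_univ]
  refine (ncard_le_mul_sum_div (u := u) (m := fun A => #A - 1) (𝓐 := s.powerset)
    fun G hG => ⟨G.neighborFinset u, neighborFinset_mem_powerset_erase G u,
      (G.coe_neighborFinset u).symm,
      ((G.neighborFinset u).erase w).image fun v => s(v, w), ?_, fun e he => ?_,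
      fun H hH hHG e he => ?_⟩).trans ?_
  · rw [card_image_of_injective _ fun v v' h => Sym2.congr_left.1 h]
    exact pred_card_le_card_erase
  · obtain ⟨v, hv, rfl⟩ := mem_image.1 he
    have huv : G.Adj u v := (G.mem_neighborFinset u v).1 (mem_of_mem_erase hv)
    simp [ne_of_mem_erase hv, huv.ne, huw]
  · obtain ⟨v, hv, rfl⟩ := mem_image.1 he
    have hGv : G.Adj u v := (G.mem_neighborFinset u v).1 (mem_of_mem_erase hv)
    have hHv : H.Adj u v := by
      rw [← SimpleGraph.mem_neighborSet, hHG]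
      exact mem_of_mem_erase hv
    exact iff_of_false (fun h => hH v ⟨hHv, h⟩) fun h => hG v ⟨hGv, h⟩
  · gcongr
    rw [div_le_iff₀ (by positivity), mul_assoc, ← mul_pow, ← hs]
    calc ∑ A ∈ s.powerset, (1 / 2 : ℝ) ^ (#A - 1) ≤ ∑ A ∈ s.powerset, 2 * (1 / 2 : ℝ) ^ #A := by
          refine sum_le_sum fun A _ => ?_
          rcases #A with _ | k
          · norm_num
          · rw [Nat.add_sub_cancel, pow_succ]
            exact le_of_eq (by ring)
      _ = 2 * (3 / 4 * 2) ^ #s := by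
          rw [← mul_sum, sum_powerset_pow_card]
          norm_num

open Classical in
/-- The pairs `s(φ N w, w)` determined by the neighbourhood `N` of `u` are distinct, as `φ N w` is
in `N` and `w` is not. -/
theorem ncard_predicted_routes_le (u : V) (φ : Set V → V → V) (k : ℕ) :
    ({G : SimpleGraph V | G.degree u + k < Fintype.card V ∧ ∀ w, w ≠ u → ¬G.Adj u w →
        G.Adj u (φ (G.neighborSet u) w) ∧ G.Adj (φ (G.neighborSet u) w) w}.ncard : ℝ) ≤
      2 ^ (Fintype.card V).choose 2 * (1 / 2) ^ k := by
  let s := univ.erase u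
  have hs : #s = Fintype.card V - 1 := by rw [card_erase_of_mem (mem_univ u), card_univ]
  refine (ncard_le_mul_sum_div (u := u) (m := fun _ => k) (𝓐 := s.powerset) ?_).trans_eq ?_
  · rintro G ⟨hdeg, hG⟩
    set A := G.neighborFinset u with hA
    have hAset : G.neighborSet u = A := (G.coe_neighborFinset u).symm
    have hAs : A ⊆ s := mem_powerset.1 (neighborFinset_mem_powerset_erase G u)
    have hroute : ∀ w ∈ s \ A, w ≠ u ∧ φ A w ∈ A ∧ s(φ A w, w) ∈ G.edgeSet := fun w hw => by
      have hwu : w ≠ u := ne_of_mem_erase (mem_sdiff.1 hw).1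
      have hroute := hG w hwu fun h => (mem_sdiff.1 hw).2 ((G.mem_neighborFinset u w).2 h)
      rw [hAset] at hroute
      exact ⟨hwu, (G.mem_neighborFinset u _).2 hroute.1, hroute.2⟩
    refine ⟨A, mem_powerset.2 hAs, hAset, (s \ A).image fun w => s(φ A w, w), ?_, ?_, ?_⟩
    · rw [card_image_of_injOn, card_sdiff_of_subset hAs, hs, hA, G.card_neighborFinset_eq_degree]
      · omega
      · intro w hw w' hw' h
        rcases Sym2.eq_iff.1 h with ⟨-, h⟩ | ⟨h, -⟩
        · exact h
        · exact absurd (h ▸ (hroute w hw).2.1) (mem_sdiff.1 hw').2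
    · intro e he
      obtain ⟨w, hw, rfl⟩ := mem_image.1 he
      obtain ⟨hwu, hφ, hedge⟩ := hroute w hw
      exact ⟨G.not_isDiag_of_mem_edgeSet hedge, fun h => (Sym2.mem_iff.1 h).elim
        (fun h => notMem_erase u univ (hAs (h ▸ hφ))) fun h => hwu h.symm⟩
    · rintro H ⟨-, hH⟩ hHA e he
      obtain ⟨w, hw, rfl⟩ := mem_image.1 he
      have hHw : ¬H.Adj u w := fun h => (mem_sdiff.1 hw).2 (mem_coe.1 (hHA ▸ h))
      have hHroute := (hH w (hroute w hw).1 hHw).2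
      rw [hHA] at hHroute
      exact iff_of_true hHroute (hroute w hw).2.2
  · rw [sum_const, card_powerset, nsmul_eq_mul, hs]
    field_simp
    norm_num

end Counting

/-! ### Three exponentially rare families -/

open Classical in
/-- The graphs with a node of degree greater than `(n + ⌊n / K⌋) / 2`. -/
def highDegreeGraphs (K n : ℕ) : Set (SimpleGraph (Fin n)) :=
  {G | ∃ u, n + n / K < 2 * G.degree u}

/-- The graphs with two nodes that have no common neighbour. -/
def noCommonNeighbourGraphs (n : ℕ) : Set (SimpleGraph (Fin n)) :=
  {G | ∃ u w, u ≠ w ∧ ∀ v, ¬(G.Adj u v ∧ G.Adj v w)}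

/-- From the string `s` stored at `u`, the interpreter `D` finds for every destination `w` that
is not adjacent to `u` a common neighbour of `u` and `w`. -/
def StoresCommonNeighbours (D : Interpreter) {n : ℕ} (G : SimpleGraph (Fin n)) (u : Fin n)
    (s : List Bool) : Prop :=
  ∀ w, w ≠ u → ¬G.Adj u w →
    ∃ v : Fin n, (v : ℕ) ∈ D s (n, u, neighbourLabels G u, w) ∧ G.Adj u v ∧ G.Adj v w

open Classical in
/-- The graphs in which the common neighbours of some node `u` and the `n - degree u - 1` nodes
not adjacent to it are stored in a string at least `⌊n / K⌋` bits shorter than this number. -/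
def terselyRoutedGraphs (D : Interpreter) (K n : ℕ) : Set (SimpleGraph (Fin n)) :=
  {G | ∃ u s, G.degree u + (s.length + n / K) < n ∧ StoresCommonNeighbours D G u s}

theorem isExponentiallyRare_highDegreeGraphs {K : ℕ} (hK : 0 < K) :
    IsExponentiallyRare (highDegreeGraphs K) := by
  classical
  set r : ℝ := Real.exp (-((1 / K) ^ 2 / 2))
  have hr₀ : 0 < r := Real.exp_pos _
  have hr : r < 1 := Real.exp_lt_one_iff.2 (neg_lt_zero.2 (by positivity))
  refine isExponentiallyRare_of_ncard_le r⁻¹ 1 hr₀.le hr fun n => ?_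
  let 𝓑 (u : Fin n) : Set (SimpleGraph (Fin n)) :=
    {G | (1 + 1 / K : ℝ) * (Fintype.card (Fin n) - 1 : ℕ) ≤ 2 * G.degree u}
  have hcover : highDegreeGraphs K n ⊆ ⋃ u, 𝓑 u := by
    rintro G ⟨u, hu⟩
    refine Set.mem_iUnion.2 ⟨u, ?_⟩
    have hfloor : (n : ℝ) / K < (n / K : ℕ) + 1 := by
      rw [← Nat.floor_div_eq_div (K := ℝ)]
      exact Nat.lt_floor_add_one _
    have hu' : (n : ℝ) + (n / K : ℕ) + 1 ≤ 2 * G.degree u := by exact_mod_cast hu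
    calc (1 + 1 / K : ℝ) * (Fintype.card (Fin n) - 1 : ℕ) ≤ (1 + 1 / K) * n := by
          gcongr
          simp
      _ = n + n / K := by ring
      _ ≤ 2 * G.degree u := by linarith
  have hcard (u : Fin n) : ((𝓑 u).ncard : ℝ) ≤ 2 ^ n.choose 2 * r ^ (n - 1) :=
    (ncard_degree_ge_le u (by positivity)).trans_eq (by rw [Fintype.card_fin])
  refine (ncard_le_card_mul_of_subset_iUnion hcover hcard).trans_eq ?_
  rw [Fintype.card_fin]
  rcases n with _ | n
  · simp
  · clear_value r
    rw [Nat.add_sub_cancel, pow_succ r n]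
    field_simp

theorem isExponentiallyRare_noCommonNeighbourGraphs :
    IsExponentiallyRare noCommonNeighbourGraphs := by
  refine isExponentiallyRare_of_ncard_le (8 / 3) 2 (r := 3 / 4) (by norm_num) (by norm_num)
    fun n => ?_
  let 𝓑 (p : Fin n × Fin n) : Set (SimpleGraph (Fin n)) :=
    {G | p.1 ≠ p.2 ∧ ∀ v, ¬(G.Adj p.1 v ∧ G.Adj v p.2)}
  have hcover : noCommonNeighbourGraphs n ⊆ ⋃ p, 𝓑 p := fun G ⟨u, w, hG⟩ =>
    Set.mem_iUnion.2 ⟨(u, w), hG⟩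
  have hcard (p : Fin n × Fin n) :
      ((𝓑 p).ncard : ℝ) ≤ 2 ^ n.choose 2 * (2 * (3 / 4) ^ (n - 1)) := by
    by_cases hp : p.1 = p.2
    · have hempty : 𝓑 p = ∅ := Set.eq_empty_of_forall_notMem fun G hG => hG.1 hp
      rw [hempty, Set.ncard_empty, Nat.cast_zero]
      positivity
    · have hno : 𝓑 p ⊆ {G | ∀ v, ¬(G.Adj p.1 v ∧ G.Adj v p.2)} := fun G hG => hG.2
      calc ((𝓑 p).ncard : ℝ) ≤ _ := Nat.cast_le.2 (Set.ncard_le_ncard hno)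
        _ ≤ _ := by simpa only [Fintype.card_fin] using ncard_no_common_neighbour_le hp
  refine (ncard_le_card_mul_of_subset_iUnion hcover hcard).trans_eq ?_
  rw [Fintype.card_prod, Fintype.card_fin]
  rcases n with _ | n
  · simp
  · rw [Nat.add_sub_cancel, pow_succ (3 / 4 : ℝ) n]
    push_cast
    ring

theorem ncard_storesCommonNeighbours_le (D : Interpreter) {n : ℕ} (u : Fin n) (s : List Bool)
    (k : ℕ) : (open Classical in {G : SimpleGraph (Fin n) | G.degree u + k < n ∧
      StoresCommonNeighbours D G u s}.ncard : ℝ) ≤ 2 ^ n.choose 2 * (1 / 2) ^ k := by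
  classical
  let labels (A : Set (Fin n)) : List ℕ := ((List.finRange n).filter fun v => v ∈ A).map Fin.val
  have hlabels (G : SimpleGraph (Fin n)) : neighbourLabels G u = labels (G.neighborSet u) :=
    neighbourLabels_eq_map G u
  let hop (A : Set (Fin n)) (w : Fin n) : Fin n :=
    if h : ∃ v : Fin n, (v : ℕ) ∈ D s (n, u, labels A, w) then h.choose else u
  have hhop {A : Set (Fin n)} {v w : Fin n} (hv : (v : ℕ) ∈ D s (n, u, labels A, w)) :
      hop A w = v := by
    have hex : ∃ v : Fin n, (v : ℕ) ∈ D s (n, u, labels A, w) := ⟨v, hv⟩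
    rw [show hop A w = hex.choose from dif_pos hex]
    exact Fin.ext (Part.mem_unique hex.choose_spec hv)
  have hcount := ncard_predicted_routes_le u hop k
  rw [Fintype.card_fin] at hcount
  refine (Nat.cast_le.2 (Set.ncard_le_ncard ?_)).trans hcount
  refine fun G hG => ⟨hG.1, fun w hwu hw => ?_⟩
  obtain ⟨v, hvD, huv, hvw⟩ := hG.2 w hwu hw
  rw [hhop (hlabels G ▸ hvD)]
  exact ⟨huv, hvw⟩

theorem one_half_pow_div_le {K : ℕ} (hK : 0 < K) (n : ℕ) :
    (1 / 2 : ℝ) ^ (n / K) ≤ 2 * ((1 / 2) ^ (1 / K : ℝ)) ^ n := by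
  set r : ℝ := (1 / 2) ^ (1 / K : ℝ)
  have hr : r ≤ 1 := Real.rpow_le_one (by norm_num) (by norm_num) (by positivity)
  have hrK : r ^ K = 1 / 2 := by
    rw [← Real.rpow_mul_natCast (by norm_num), one_div_mul_cancel (by positivity), Real.rpow_one]
  calc (1 / 2 : ℝ) ^ (n / K) = 2 * r ^ (K * (n / K + 1)) := by
        rw [pow_mul, hrK, pow_succ]
        ring
    _ ≤ 2 * r ^ n := by
        gcongr 2 * ?_
        exact pow_le_pow_of_le_one (by positivity) hr (Nat.lt_mul_div_succ n hK).le

theorem isExponentiallyRare_terselyRoutedGraphs (D : Interpreter) {K : ℕ} (hK : 0 < K) :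
    IsExponentiallyRare (terselyRoutedGraphs D K) := by
  classical
  set r : ℝ := (1 / 2) ^ (1 / K : ℝ)
  have hr₀ : 0 ≤ r := by positivity
  have hr : r < 1 := Real.rpow_lt_one (by norm_num) (by norm_num) (by positivity)
  refine isExponentiallyRare_of_ncard_le 2 2 hr₀ hr fun n => ?_
  let 𝓑 (u : Fin n) (s : List Bool) : Set (SimpleGraph (Fin n)) :=
    {G | G.degree u + (s.length + n / K) < n ∧ StoresCommonNeighbours D G u s}
  let 𝓒 (p : Fin n × Fin n) : Set (SimpleGraph (Fin n)) :=
    ⋃ s : List.Vector Bool p.2, 𝓑 p.1 s.toList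
  have hcover : terselyRoutedGraphs D K n ⊆ ⋃ p, 𝓒 p := by
    rintro G ⟨u, s, hlen, hs⟩
    have hs_lt : s.length < n := (le_add_left le_self_add).trans_lt hlen
    exact Set.mem_iUnion.2 ⟨(u, ⟨s.length, hs_lt⟩), Set.mem_iUnion.2 ⟨⟨s, rfl⟩, hlen, hs⟩⟩
  have hcard (p : Fin n × Fin n) : ((𝓒 p).ncard : ℝ) ≤ 2 ^ n.choose 2 * (2 * r ^ n) := by
    have hstring (s : List.Vector Bool p.2) : ((𝓑 p.1 s.toList).ncard : ℝ) ≤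
        2 ^ n.choose 2 * (1 / 2) ^ (p.2 + n / K : ℕ) := by
      simpa only [𝓑, s.toList_length] using
        ncard_storesCommonNeighbours_le D p.1 s.toList (s.toList.length + n / K)
    refine (ncard_le_card_mul_of_subset_iUnion subset_rfl hstring).trans ?_
    calc (Fintype.card (List.Vector Bool p.2) : ℝ) * (2 ^ n.choose 2 * (1 / 2) ^ (p.2 + n / K : ℕ))
        = 2 ^ n.choose 2 * (1 / 2) ^ (n / K) := by
          rw [card_vector, Fintype.card_bool, pow_add, one_div_pow]
          push_cast
          field_simp
      _ ≤ 2 ^ n.choose 2 * (2 * r ^ n) := by gcongr; exact one_half_pow_div_le hK n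
  refine (ncard_le_card_mul_of_subset_iUnion hcover hcard).trans_eq ?_
  rw [Fintype.card_prod, Fintype.card_fin]
  push_cast
  ring

/-! ### Enumerating the three families -/

section Predicates

variable {α : Type*} [Primcodable α] {n u : α → ℕ} {a : α → List (ℕ × ℕ)}

theorem rePred_noCommonNeighbour {w : α → ℕ} (hn : Primrec n) (ha : Primrec a) (hu : Primrec u)
    (hw : Primrec w) : REPred fun x => ∀ v < n x,
      ¬((edgeListGraph (a x)).Adj (u x) v ∧ (edgeListGraph (a x)).Adj v (w x)) := by
  have ha' := ha.comp (Primrec.fst (α := α) (β := ℕ))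
  exact rePred_forall_lt (rePred_of_primrecPred
    ((primrecPred_adj ha' (hu.comp Primrec.fst) Primrec.snd).and
      (primrecPred_adj ha' Primrec.snd (hw.comp Primrec.fst))).not) hn

theorem rePred_storesCommonNeighbours {D : Interpreter} (hD : Partrec₂ D) {s : α → List Bool}
    (hn : Primrec n) (ha : Primrec a) (hu : Primrec u) (hs : Primrec s) :
    REPred fun x => ∀ w < n x, (w = u x ∨ (edgeListGraph (a x)).Adj (u x) w) ∨
      ∃ v, v ∈ D (s x) (n x, u x, neighbourLabelsOfEdges (n x) (a x) (u x), w) ∧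
        v < n x ∧ (edgeListGraph (a x)).Adj (u x) v ∧ (edgeListGraph (a x)).Adj v w := by
  have hx : Primrec fun y : (α × ℕ) × ℕ => y.1.1 := Primrec.fst.comp Primrec.fst
  have hw : Primrec fun y : (α × ℕ) × ℕ => y.1.2 := Primrec.snd.comp Primrec.fst
  have hargs : Primrec fun y : (α × ℕ) × ℕ => (n y.1.1, u y.1.1,
      neighbourLabelsOfEdges (n y.1.1) (a y.1.1) (u y.1.1), y.1.2) :=
    (hn.comp hx).pair ((hu.comp hx).pair
      ((primrec_neighbourLabelsOfEdges (hn.comp hx) (ha.comp hx) (hu.comp hx)).pair hw))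
  have hadj : PrimrecPred fun y : α × ℕ => (edgeListGraph (a y.1)).Adj (u y.1) y.2 :=
    primrecPred_adj (ha.comp Primrec.fst) (hu.comp Primrec.fst) Primrec.snd
  have hhop : REPred fun y : (α × ℕ) × ℕ =>
      y.2 ∈ D (s y.1.1) (n y.1.1, u y.1.1,
          neighbourLabelsOfEdges (n y.1.1) (a y.1.1) (u y.1.1), y.1.2) ∧
        y.2 < n y.1.1 ∧ (edgeListGraph (a y.1.1)).Adj (u y.1.1) y.2 ∧
          (edgeListGraph (a y.1.1)).Adj y.2 y.1.2 :=
    rePred_and (rePred_mem (hD.comp (hs.comp hx).to_comp hargs.to_comp) Primrec.snd.to_comp)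
      (rePred_of_primrecPred ((Primrec.nat_lt.comp Primrec.snd (hn.comp hx)).and
        ((primrecPred_adj (ha.comp hx) (hu.comp hx) Primrec.snd).and
          (primrecPred_adj (ha.comp hx) Primrec.snd hw))))
  have hrouted : REPred fun y : α × ℕ =>
      (y.2 = u y.1 ∨ (edgeListGraph (a y.1)).Adj (u y.1) y.2) ∨
        ∃ v, v ∈ D (s y.1) (n y.1, u y.1, neighbourLabelsOfEdges (n y.1) (a y.1) (u y.1), y.2) ∧
          v < n y.1 ∧ (edgeListGraph (a y.1)).Adj (u y.1) v ∧ (edgeListGraph (a y.1)).Adj v y.2 :=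
    rePred_or (rePred_of_primrecPred
      ((Primrec.eq.comp Primrec.snd (hu.comp Primrec.fst)).or hadj)) (rePred_exists hhop)
  exact rePred_forall_lt hrouted hn

end Predicates

theorem isREFamily_highDegreeGraphs (K : ℕ) : IsREFamily (highDegreeGraphs K) := by
  classical
  have hn : Primrec fun r : (ℕ × List (ℕ × ℕ)) × ℕ => r.1.1 := Primrec.fst.comp Primrec.fst
  have hlabels := primrec_neighbourLabelsOfEdges hn (Primrec.snd.comp Primrec.fst) Primrec.snd
  have hre : REPred fun q : ℕ × List (ℕ × ℕ) => ∃ u, u < q.1 ∧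
      q.1 + q.1 / K < 2 * (neighbourLabelsOfEdges q.1 q.2 u).length :=
    rePred_exists (rePred_of_primrecPred ((Primrec.nat_lt.comp Primrec.snd hn).and
      (Primrec.nat_lt.comp (Primrec.nat_add.comp hn (Primrec.nat_div.comp hn (Primrec.const K)))
        (Primrec.nat_mul.comp (Primrec.const 2) (Primrec.list_length.comp hlabels)))))
  refine hre.of_eq fun ⟨n, a⟩ => ?_
  simp only [highDegreeGraphs, Set.mem_ofPred_eq, Fin.exists_iff, ← length_neighbourLabels,
    neighbourLabels_graphOfEdges, exists_prop]

theorem isREFamily_noCommonNeighbourGraphs : IsREFamily noCommonNeighbourGraphs := by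
  have hn : Primrec fun r : ((ℕ × List (ℕ × ℕ)) × ℕ) × ℕ => r.1.1.1 :=
    Primrec.fst.comp (Primrec.fst.comp Primrec.fst)
  have ha : Primrec fun r : ((ℕ × List (ℕ × ℕ)) × ℕ) × ℕ => r.1.1.2 :=
    Primrec.snd.comp (Primrec.fst.comp Primrec.fst)
  have hu : Primrec fun r : ((ℕ × List (ℕ × ℕ)) × ℕ) × ℕ => r.1.2 := Primrec.snd.comp Primrec.fst
  have hre : REPred fun q : ℕ × List (ℕ × ℕ) => ∃ u w, (u < q.1 ∧ w < q.1 ∧ u ≠ w) ∧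
      ∀ v < q.1, ¬((edgeListGraph q.2).Adj u v ∧ (edgeListGraph q.2).Adj v w) :=
    rePred_exists (rePred_exists (rePred_and
      (rePred_of_primrecPred ((Primrec.nat_lt.comp hu hn).and
        ((Primrec.nat_lt.comp Primrec.snd hn).and (Primrec.eq.comp hu Primrec.snd).not)))
      (rePred_noCommonNeighbour hn ha hu Primrec.snd)))
  refine hre.of_eq fun ⟨n, a⟩ => ?_
  simp only [noCommonNeighbourGraphs, Set.mem_ofPred_eq, Fin.exists_iff, Fin.forall_iff]
  constructor
  · rintro ⟨u, w, ⟨hu, hw, huw⟩, h⟩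
    exact ⟨u, hu, w, hw, Fin.ne_of_val_ne huw, h⟩
  · rintro ⟨u, hu, w, hw, huw, h⟩
    exact ⟨u, w, ⟨hu, hw, Fin.val_ne_of_ne huw⟩, h⟩

theorem storesCommonNeighbours_graphOfEdges {D : Interpreter} {n : ℕ} {a : List (ℕ × ℕ)}
    {u : Fin n} {s : List Bool} :
    StoresCommonNeighbours D (graphOfEdges n a) u s ↔
      ∀ w < n, (w = u ∨ (edgeListGraph a).Adj u w) ∨
        ∃ v, v ∈ D s (n, u, neighbourLabelsOfEdges n a u, w) ∧
          v < n ∧ (edgeListGraph a).Adj u v ∧ (edgeListGraph a).Adj v w := by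
  rw [StoresCommonNeighbours, neighbourLabels_graphOfEdges, Fin.forall_iff]
  refine forall₂_congr fun w hw => ?_
  rw [Fin.ne_iff_vne, or_assoc, Ne, ← or_iff_not_imp_left, ← or_iff_not_imp_left]
  refine or_congr_right (or_congr_right ⟨?_, ?_⟩)
  · rintro ⟨v, hvD, huv, hvw⟩
    exact ⟨v, hvD, v.isLt, huv, hvw⟩
  · rintro ⟨v, hvD, hv, huv, hvw⟩
    exact ⟨⟨v, hv⟩, hvD, huv, hvw⟩

theorem isREFamily_terselyRoutedGraphs {D : Interpreter} (hD : Partrec₂ D) (K : ℕ) :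
    IsREFamily (terselyRoutedGraphs D K) := by
  classical
  have hn : Primrec fun r : ((ℕ × List (ℕ × ℕ)) × ℕ) × List Bool => r.1.1.1 :=
    Primrec.fst.comp (Primrec.fst.comp Primrec.fst)
  have ha : Primrec fun r : ((ℕ × List (ℕ × ℕ)) × ℕ) × List Bool => r.1.1.2 :=
    Primrec.snd.comp (Primrec.fst.comp Primrec.fst)
  have hu : Primrec fun r : ((ℕ × List (ℕ × ℕ)) × ℕ) × List Bool => r.1.2 :=
    Primrec.snd.comp Primrec.fst
  have hlength := Primrec.list_length.comp (primrec_neighbourLabelsOfEdges hn ha hu)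
  have hshort : PrimrecPred fun r : ((ℕ × List (ℕ × ℕ)) × ℕ) × List Bool => r.1.2 < r.1.1.1 ∧
      (neighbourLabelsOfEdges r.1.1.1 r.1.1.2 r.1.2).length + (r.2.length + r.1.1.1 / K) <
        r.1.1.1 :=
    (Primrec.nat_lt.comp hu hn).and (Primrec.nat_lt.comp (Primrec.nat_add.comp hlength
      (Primrec.nat_add.comp (Primrec.list_length.comp Primrec.snd)
        (Primrec.nat_div.comp hn (Primrec.const K)))) hn)
  have hre : REPred fun q : ℕ × List (ℕ × ℕ) => ∃ u s,
      (u < q.1 ∧ (neighbourLabelsOfEdges q.1 q.2 u).length + (s.length + q.1 / K) < q.1) ∧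
      ∀ w < q.1, (w = u ∨ (edgeListGraph q.2).Adj u w) ∨
        ∃ v, v ∈ D s (q.1, u, neighbourLabelsOfEdges q.1 q.2 u, w) ∧
          v < q.1 ∧ (edgeListGraph q.2).Adj u v ∧ (edgeListGraph q.2).Adj v w :=
    rePred_exists (rePred_exists (rePred_and (rePred_of_primrecPred hshort)
      (rePred_storesCommonNeighbours hD hn ha hu Primrec.snd)))
  refine hre.of_eq fun ⟨n, a⟩ => ?_
  simp only [terselyRoutedGraphs, Set.mem_ofPred_eq, Fin.exists_iff, and_assoc, exists_and_left,
    exists_prop, ← length_neighbourLabels, neighbourLabels_graphOfEdges,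
    storesCommonNeighbours_graphOfEdges]

/-! ### Routing in random graphs -/

section Routing

variable {n : ℕ} {G : SimpleGraph (Fin n)} {F : Fin n → Fin n → Fin n} {u v w : Fin n}

theorem delivers_zero_iff : Delivers G F w 0 v ↔ v = w :=
  ⟨fun h => by cases h; rfl, fun h => h ▸ .arrive⟩

theorem delivers_succ_iff {k : ℕ} :
    Delivers G F w (k + 1) v ↔ v ≠ w ∧ G.Adj v (F v w) ∧ Delivers G F w k (F v w) := by
  refine ⟨fun h => ?_, fun ⟨hne, hadj, h⟩ => .step hne hadj h⟩
  cases h with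
  | step hne hadj h => exact ⟨hne, hadj, h⟩

theorem adj_of_delivers_two (h : Delivers G F w 2 u) : G.Adj u (F u w) ∧ G.Adj (F u w) w := by
  obtain ⟨-, hfirst, hrest⟩ := delivers_succ_iff.1 h
  obtain ⟨-, hsecond, hlast⟩ := delivers_succ_iff.1 hrest
  exact ⟨hfirst, by rwa [delivers_zero_iff.1 hlast] at hsecond⟩

theorem IsShortestPathScheme.storesCommonNeighbours {D : Interpreter} {s : List Bool}
    (hF : IsShortestPathScheme G F) (hs : Stores D G u s (F u))
    (hcommon : ∀ w, w ≠ u → ∃ v, G.Adj u v ∧ G.Adj v w) : StoresCommonNeighbours D G u s := by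
  intro w hwu hadj
  obtain ⟨v, huv, hvw⟩ := hcommon w hwu
  have hreach : G.Reachable u w := huv.reachable.trans hvw.reachable
  have hdist : G.dist u w = 2 := by
    rw [SimpleGraph.dist, SimpleGraph.edist_eq_two_iff.2 ⟨hwu.symm, hadj, v, huv, hvw.symm⟩]
    rfl
  exact ⟨F u w, hs w hwu hreach, adj_of_delivers_two (hdist ▸ hF u w hreach)⟩

end Routing

theorem eventually_le_two_mul_length {U : Machine} (hU : IsUniversal U) {D : Interpreter}
    (hD : Partrec₂ D) {δ : ℕ → ℝ} (hδ : δ =o[atTop] fun n : ℕ => (n : ℝ)) {K : ℕ} (hK : 0 < K) :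
    ∀ᶠ n : ℕ in atTop, ∀ (d : ℕ) (G : SimpleGraph (Fin n)), IsRandomGraph U δ d G →
      ∀ F : Fin n → Fin n → Fin n, IsShortestPathScheme G F →
        ∀ (u : Fin n) (s : List Bool), Stores D G u s (F u) →
          n ≤ 2 * s.length + 3 * (n / K) := by
  filter_upwards [
    eventually_notMem_of_isRandomGraph hU hδ (isREFamily_highDegreeGraphs K)
      (isExponentiallyRare_highDegreeGraphs hK),
    eventually_notMem_of_isRandomGraph hU hδ isREFamily_noCommonNeighbourGraphs
      isExponentiallyRare_noCommonNeighbourGraphs,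
    eventually_notMem_of_isRandomGraph hU hδ (isREFamily_terselyRoutedGraphs hD K)
      (isExponentiallyRare_terselyRoutedGraphs D hK)]
    with n hdegree hcommon hterse d G hG F hF u s hs
  classical
  have hdegree_le : 2 * G.degree u ≤ n + n / K := by
    by_contra! hlt
    exact hdegree d G hG ⟨u, by convert hlt⟩
  have hstores : StoresCommonNeighbours D G u s := by
    refine hF.storesCommonNeighbours hs fun w hwu => ?_
    by_contra! hno
    exact hcommon d G hG ⟨u, w, hwu.symm, fun v hv => hno v hv.1 hv.2⟩
  have hle_length : n ≤ G.degree u + (s.length + n / K) := by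
    by_contra! hlt
    exact hterse d G hG ⟨u, s, by convert hlt, hstores⟩
  omega

theorem exists_isLittleO_forall_mem_le {ι : Type*} {l : Filter ι} {g : ι → ℝ} {S : ι → Set ℝ}
    (hbdd : ∀ i, BddAbove (S i))
    (hS : ∀ c > 0, ∀ᶠ i in l, ∀ x ∈ S i, x ≤ c * ‖g i‖) :
    ∃ f : ι → ℝ, f =o[l] g ∧ ∀ i, ∀ x ∈ S i, x ≤ f i := by
  have hbdd' i : BddAbove (insert 0 (S i)) := (hbdd i).insert 0
  refine ⟨fun i => sSup (insert 0 (S i)), Asymptotics.isLittleO_iff.2 fun c hc => ?_,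
    fun i x hx => le_csSup (hbdd' i) (Set.mem_insert_of_mem 0 hx)⟩
  filter_upwards [hS c hc] with i hi
  rw [Real.norm_of_nonneg (le_csSup (hbdd' i) (Set.mem_insert 0 _))]
  exact csSup_le (Set.insert_nonempty _ _)
    (Set.forall_mem_insert.2 ⟨by positivity, hi⟩)

theorem eventually_half_sub_length_le {U : Machine} (hU : IsUniversal U) {D : Interpreter}
    (hD : Partrec₂ D) {δ : ℕ → ℝ} (hδ : δ =o[atTop] fun n : ℕ => (n : ℝ)) {c : ℝ} (hc : 0 < c) :
    ∀ᶠ n : ℕ in atTop, ∀ (d : ℕ) (G : SimpleGraph (Fin n)), IsRandomGraph U δ d G →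
      ∀ F : Fin n → Fin n → Fin n, IsShortestPathScheme G F →
        ∀ (u : Fin n) (s : List Bool), Stores D G u s (F u) →
          (n : ℝ) / 2 - s.length ≤ c * n := by
  obtain ⟨K, hK⟩ := exists_nat_ge (3 / (2 * c))
  have hK_pos : 0 < (K : ℝ) := (by positivity : 0 < 3 / (2 * c)).trans_le hK
  have hK_inv : 3 / (2 * (K : ℝ)) ≤ c := by
    rw [div_le_iff₀ (by positivity)] at hK ⊢
    linarith
  filter_upwards [eventually_le_two_mul_length hU hD hδ (Nat.cast_pos.1 hK_pos)]
    with n hn d G hG F hF u s hs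
  have hle : (n : ℝ) ≤ 2 * s.length + 3 * (n / K : ℕ) := by exact_mod_cast hn d G hG F hF u s hs
  calc (n : ℝ) / 2 - s.length ≤ 3 / 2 * (n / K : ℕ) := by linarith
    _ ≤ 3 / 2 * (n / K) := by gcongr; exact Nat.cast_div_le
    _ = 3 / (2 * K) * n := by ring
    _ ≤ c * n := by gcongr

theorem exists_isLittleO_half_sub_le_length {U : Machine} (hU : IsUniversal U) {D : Interpreter}
    (hD : Partrec₂ D) {δ : ℕ → ℝ} (hδ : δ =o[atTop] fun n : ℕ => (n : ℝ)) :
    ∃ f : ℕ → ℝ, f =o[atTop] (fun n : ℕ => (n : ℝ)) ∧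
      ∀ (n d : ℕ) (G : SimpleGraph (Fin n)), IsRandomGraph U δ d G →
        ∀ F : Fin n → Fin n → Fin n, IsShortestPathScheme G F →
          ∀ (u : Fin n) (s : List Bool), Stores D G u s (F u) →
            (n : ℝ) / 2 - f n ≤ s.length := by
  let deficits (n : ℕ) : Set ℝ := {x | ∃ (d : ℕ) (G : SimpleGraph (Fin n))
    (F : Fin n → Fin n → Fin n) (u : Fin n) (s : List Bool), IsRandomGraph U δ d G ∧
      IsShortestPathScheme G F ∧ Stores D G u s (F u) ∧ x = (n : ℝ) / 2 - s.length}
  have hbdd n : BddAbove (deficits n) := by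
    refine ⟨(n : ℝ) / 2, ?_⟩
    rintro x ⟨d, G, F, u, s, -, -, -, rfl⟩
    exact sub_le_self _ (Nat.cast_nonneg _)
  obtain ⟨f, hf, hle⟩ := exists_isLittleO_forall_mem_le (g := fun n : ℕ => (n : ℝ)) hbdd
    fun c hc => by
      filter_upwards [eventually_half_sub_length_le hU hD hδ hc] with n hn
      rintro x ⟨d, G, F, u, s, hG, hF, hs, rfl⟩
      rw [Real.norm_natCast]
      exact hn d G hG F hF u s hs
  exact ⟨f, hf, fun n d G hG F hF u s hs =>
    sub_le_comm.1 (hle n _ ⟨d, G, F, u, s, hG, hF, hs, rfl⟩)⟩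

end CompactRouting

theorem mainTheorem2 (U : CompactRouting.Machine) (hU : CompactRouting.IsUniversal U)
    (D : CompactRouting.Interpreter) (hD : Partrec₂ D)
    (δ : ℕ → ℝ) (hδ : δ =o[Filter.atTop] fun n : ℕ => (n : ℝ)) :
    ∃ f g : ℕ → ℝ,
      f =o[Filter.atTop] (fun n : ℕ => (n : ℝ)) ∧
      g =o[Filter.atTop] (fun n : ℕ => (n : ℝ) ^ 2) ∧
      ∀ (n d : ℕ) (G : SimpleGraph (Fin n)), CompactRouting.IsRandomGraph U δ d G →
        ∀ F : Fin n → Fin n → Fin n, CompactRouting.IsShortestPathScheme G F →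
          (∀ (u : Fin n) (s : List Bool), CompactRouting.Stores D G u s (F u) →
            (n : ℝ) / 2 - f n ≤ (s.length : ℝ)) ∧
          (∀ s : Fin n → List Bool, (∀ u, CompactRouting.Stores D G u (s u) (F u)) →
            (n : ℝ) ^ 2 / 2 - g n ≤ ∑ u, ((s u).length : ℝ)) := by
  obtain ⟨f, hf, hnode⟩ := CompactRouting.exists_isLittleO_half_sub_le_length hU hD hδ
  refine ⟨f, fun n => n * f n, hf, ?_, fun n d G hG F hF => ⟨hnode n d G hG F hF, fun s hs => ?_⟩⟩
  · simpa only [sq] using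
      (Asymptotics.isBigO_refl (fun n : ℕ => (n : ℝ)) Filter.atTop).mul_isLittleO hf
  · calc (n : ℝ) ^ 2 / 2 - n * f n = ∑ _u : Fin n, ((n : ℝ) / 2 - f n) := by
          rw [Finset.sum_const, Finset.card_univ, Fintype.card_fin, nsmul_eq_mul]
          ring
      _ ≤ ∑ u, ((s u).length : ℝ) :=
          Finset.sum_le_sum fun u _ => hnode n d G hG F hF u (s u) (hs u)
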